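/- Let $K$ be a field of characteristic different from $2$ and $3$. Let $\mathbb O$ be an octonion algebra over $K$, i.e. the $8$-dimensional algebra obtained from $K$ by the Cayley–Dickson process with nonzero parameters $a,b,c\in K$ (this includes the split octonion algebra, and the algebra with the standard basis $1,e_1,\dots,e_7$ with $e_i^2=-1$, where $a=b=c=-1$), with its standard conjugation $x\mapsto\overline{x}$. Let $n\ge 1$ be an integer, let $M_n(\mathbb O)$ be the algebra of $n\times n$ matrices over $\mathbb O$, and let $J:(a_{ij})\mapsto(\overline{a_{ji}})$. Let $A$ be either the algebra of Hermitian octonionic matrices $\{x\in M_n(\mathbb O) : J(x)=x\}$ with the product $x\circ y=\frac12(xy+yx)$, or the algebra of skew-Hermitian octonionic matrices $\{x\in M_n(\mathbb O) : J(x)=-x\}$ with the product $[x,y]=xy-yx$. Let $\delta\in K$, and let $D:A\to A$ be a nonzero $\delta$-derivation of $A$, i.e. a nonzero $K$-linear map such that, with $\cdot$ denoting the product of $A$, $$D(x\cdot y)=\delta\, D(x)\cdot y+\delta\, x\cdot D(y)\qquad\text{for all } x,y\in A.$$ Then either $\delta=1$ (so $D$ is an ordinary derivation), or $\delta=\frac12$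 and $D=t\,\mathrm{id}_A$ for some $t\in K$. -/

import Mathlib

open scoped Matrix

/-- The octonion algebra over `K` with Cayley-Dickson parameters `a`, `b`, `c`: the
Cayley-Dickson double, with parameter `c`, of the quaternion algebra with `i ^ 2 = a`,
`j ^ 2 = b`, `i j = - j i`. The pair `(x, y)` is the element `x + y ℓ`, where `ℓ ^ 2 = c`. -/
@[ext]
structure Octonion {K : Type*} [Field K] (a b c : K) where
  fst : QuaternionAlgebra K a 0 b
  snd : QuaternionAlgebra K a 0 b

namespace Octonion

variable {K : Type*} [Field K] {a b c : K}

instance : Zero (Octonion a b c) := ⟨⟨0, 0⟩⟩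
instance : One (Octonion a b c) := ⟨⟨1, 0⟩⟩
instance : Add (Octonion a b c) := ⟨fun x y => ⟨x.fst + y.fst, x.snd + y.snd⟩⟩
instance : Neg (Octonion a b c) := ⟨fun x => ⟨-x.fst, -x.snd⟩⟩
instance : Sub (Octonion a b c) := ⟨fun x y => ⟨x.fst - y.fst, x.snd - y.snd⟩⟩
instance {S : Type*} [SMul S K] : SMul S (Octonion a b c) :=
  ⟨fun s x => ⟨s • x.fst, s • x.snd⟩⟩

/-- The Cayley-Dickson product `(x, y) (u, v) = (x u + c v̄ y, v x + y ū)`. -/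
instance : Mul (Octonion a b c) :=
  ⟨fun x y => ⟨x.fst * y.fst + c • (star y.snd * x.snd), y.snd * x.fst + x.snd * star y.fst⟩⟩

/-- The standard conjugation. -/
instance : Star (Octonion a b c) := ⟨fun x => ⟨star x.fst, -x.snd⟩⟩

@[simp] theorem fst_zero : (0 : Octonion a b c).fst = 0 := rfl
@[simp] theorem snd_zero : (0 : Octonion a b c).snd = 0 := rfl
@[simp] theorem fst_one : (1 : Octonion a b c).fst = 1 := rfl
@[simp] theorem snd_one : (1 : Octonion a b c).snd = 0 := rfl
@[simp] theorem fst_add (x y : Octonion a b c) : (x + y).fst = x.fst + y.fst := rfl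
@[simp] theorem snd_add (x y : Octonion a b c) : (x + y).snd = x.snd + y.snd := rfl
@[simp] theorem fst_neg (x : Octonion a b c) : (-x).fst = -x.fst := rfl
@[simp] theorem snd_neg (x : Octonion a b c) : (-x).snd = -x.snd := rfl
@[simp] theorem fst_sub (x y : Octonion a b c) : (x - y).fst = x.fst - y.fst := rfl
@[simp] theorem snd_sub (x y : Octonion a b c) : (x - y).snd = x.snd - y.snd := rfl
@[simp] theorem fst_smul {S : Type*} [SMul S K] (s : S) (x : Octonion a b c) :
    (s • x).fst = s • x.fst := rfl
@[simp] theorem snd_smul {S : Type*} [SMul S K] (s : S) (x : Octonion a b c) :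
    (s • x).snd = s • x.snd := rfl
@[simp] theorem fst_mul (x y : Octonion a b c) :
    (x * y).fst = x.fst * y.fst + c • (star y.snd * x.snd) := rfl
@[simp] theorem snd_mul (x y : Octonion a b c) :
    (x * y).snd = y.snd * x.fst + x.snd * star y.fst := rfl
@[simp] theorem fst_star (x : Octonion a b c) : (star x).fst = star x.fst := rfl
@[simp] theorem snd_star (x : Octonion a b c) : (star x).snd = -x.snd := rfl

instance : AddCommGroup (Octonion a b c) where
  add_assoc _ _ _ := by ext1 <;> simp [add_assoc]
  zero_add _ := by ext1 <;> simp
  add_zero _ := by ext1 <;> simp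
  add_comm _ _ := by ext1 <;> simp [add_comm]
  neg_add_cancel _ := by ext1 <;> simp
  sub_eq_add_neg _ _ := by ext1 <;> simp [sub_eq_add_neg]
  nsmul := (· • ·)
  nsmul_zero _ := by ext1 <;> simp
  nsmul_succ _ _ := by ext1 <;> simp [add_mul]
  zsmul := (· • ·)
  zsmul_zero' _ := by ext1 <;> simp
  zsmul_succ' _ _ := by ext1 <;> simp [add_mul]
  zsmul_neg' _ _ := by ext1 <;> simp [Int.negSucc_eq, add_mul]

instance : NonAssocRing (Octonion a b c) where
  left_distrib _ _ _ := by
    ext1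
    · simp only [fst_mul, fst_add, snd_add, star_add, mul_add, add_mul, smul_add]; abel
    · simp only [snd_mul, fst_add, snd_add, star_add, mul_add, add_mul]; abel
  right_distrib _ _ _ := by
    ext1
    · simp only [fst_mul, fst_add, snd_add, mul_add, add_mul, smul_add]; abel
    · simp only [snd_mul, fst_add, snd_add, mul_add, add_mul]; abel
  zero_mul _ := by ext1 <;> simp
  mul_zero _ := by ext1 <;> simp
  one_mul _ := by ext1 <;> simp
  mul_one _ := by ext1 <;> simp

instance : Module K (Octonion a b c) where
  one_smul _ := by ext1 <;> simp
  mul_smul _ _ _ := by ext1 <;> simp [mul_smul]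
  smul_zero _ := by ext1 <;> simp
  smul_add _ _ _ := by ext1 <;> simp
  add_smul _ _ _ := by ext1 <;> simp [add_smul]
  zero_smul _ := by ext1 <;> simp

instance : IsScalarTower K (Octonion a b c) (Octonion a b c) where
  smul_assoc s x y := by
    ext1
    · simp [smul_comm s c]
    · simp

instance : SMulCommClass K (Octonion a b c) (Octonion a b c) where
  smul_comm s x y := by
    ext1
    · simp [smul_comm s c]
    · simp

/-- Conjugation is an additive involutive antiautomorphism. -/
instance : StarRing (Octonion a b c) where
  star_involutive _ := by ext1 <;> simp
  star_add _ _ := by ext1 <;> simp [add_comm]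
  star_mul x y := by
    ext1
    · simp
    · simp only [snd_mul, snd_star, fst_star, star_star]; simp [add_comm]

theorem star_smul' (s : K) (x : Octonion a b c) : star (s • x) = s • star x := by
  ext1 <;> simp

end Octonion

/-- The product of a (not necessarily associative) algebra `A` is a bilinear map
`A →ₗ[K] A →ₗ[K] A`. A linear map `D` is a `δ`-derivation for the product `μ` if
`D (x y) = δ D(x) y + δ x D(y)` for all `x`, `y`. -/
def IsDeltaDerivation {K A : Type*} [Field K] [AddCommGroup A] [Module K A]
    (μ : A →ₗ[K] A →ₗ[K] A) (δ : K) (D : A →ₗ[K] A) : Prop :=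
  ∀ x y : A, D (μ x y) = δ • μ (D x) y + δ • μ x (D y)

section OctonionMatrices

variable {K : Type*} [Field K] (a b c : K) (n : ℕ)

theorem octonionMatrix_conjTranspose_smul (s : K)
    (X : Matrix (Fin n) (Fin n) (Octonion a b c)) : (s • X)ᴴ = s • Xᴴ := by
  ext1 i j
  simp [Matrix.conjTranspose_apply, Octonion.star_smul']

/-- The space of Hermitian `n × n` matrices over the octonions. -/
def hermitianOctonionMatrix : Submodule K (Matrix (Fin n) (Fin n) (Octonion a b c)) where
  carrier := {X | Xᴴ = X}
  add_mem' := by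
    intro X Y hX hY
    simp only [Set.mem_ofPred_eq] at *
    rw [Matrix.conjTranspose_add, hX, hY]
  zero_mem' := Matrix.conjTranspose_zero
  smul_mem' := by
    intro s X hX
    simp only [Set.mem_ofPred_eq] at *
    rw [octonionMatrix_conjTranspose_smul, hX]

/-- The space of skew-Hermitian `n × n` matrices over the octonions. -/
def skewHermitianOctonionMatrix : Submodule K (Matrix (Fin n) (Fin n) (Octonion a b c)) where
  carrier := {X | Xᴴ = -X}
  add_mem' := by
    intro X Y hX hY
    simp only [Set.mem_ofPred_eq] at *
    rw [Matrix.conjTranspose_add, hX, hY, neg_add]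
  zero_mem' := by simp
  smul_mem' := by
    intro s X hX
    simp only [Set.mem_ofPred_eq] at *
    rw [octonionMatrix_conjTranspose_smul, hX, smul_neg]

/-- The product `X ∘ Y = (X Y + Y X) / 2` of the algebra of Hermitian octonionic matrices. -/
def hermitianOctonionMatrixMul :
    hermitianOctonionMatrix a b c n →ₗ[K] hermitianOctonionMatrix a b c n →ₗ[K]
      hermitianOctonionMatrix a b c n :=
  LinearMap.mk₂ K
    (fun X Y => ⟨(2 : K)⁻¹ • (X.1 * Y.1 + Y.1 * X.1), by
      have hX : X.1ᴴ = X.1 := X.2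
      have hY : Y.1ᴴ = Y.1 := Y.2
      change ((2 : K)⁻¹ • (X.1 * Y.1 + Y.1 * X.1))ᴴ = (2 : K)⁻¹ • (X.1 * Y.1 + Y.1 * X.1)
      rw [octonionMatrix_conjTranspose_smul, Matrix.conjTranspose_add,
        Matrix.conjTranspose_mul, Matrix.conjTranspose_mul, hX, hY, add_comm]⟩)
    (fun X X' Y => Subtype.ext (by
      simp only [Submodule.coe_add, add_mul, mul_add, smul_add]; abel))
    (fun s X Y => Subtype.ext (by
      simp only [Submodule.coe_smul, Matrix.smul_mul, Matrix.mul_smul, ← smul_add]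
      rw [smul_comm]))
    (fun X Y Y' => Subtype.ext (by
      simp only [Submodule.coe_add, add_mul, mul_add, smul_add]; abel))
    (fun s X Y => Subtype.ext (by
      simp only [Submodule.coe_smul, Matrix.smul_mul, Matrix.mul_smul, ← smul_add]
      rw [smul_comm]))

/-- The product `[X, Y] = X Y - Y X` of the algebra of skew-Hermitian octonionic matrices. -/
def skewHermitianOctonionMatrixMul :
    skewHermitianOctonionMatrix a b c n →ₗ[K] skewHermitianOctonionMatrix a b c n →ₗ[K]
      skewHermitianOctonionMatrix a b c n :=
  LinearMap.mk₂ K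
    (fun X Y => ⟨X.1 * Y.1 - Y.1 * X.1, by
      have hX : X.1ᴴ = -X.1 := X.2
      have hY : Y.1ᴴ = -Y.1 := Y.2
      change (X.1 * Y.1 - Y.1 * X.1)ᴴ = -(X.1 * Y.1 - Y.1 * X.1)
      rw [Matrix.conjTranspose_sub,
        Matrix.conjTranspose_mul, Matrix.conjTranspose_mul, hX, hY, neg_mul_neg, neg_mul_neg,
        neg_sub]⟩)
    (fun X X' Y => Subtype.ext (by
      simp only [Submodule.coe_add, add_mul, mul_add]; abel))
    (fun s X Y => Subtype.ext (by
      simp only [Submodule.coe_smul, Matrix.smul_mul, Matrix.mul_smul, ← smul_sub]))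
    (fun X Y Y' => Subtype.ext (by
      simp only [Submodule.coe_add, add_mul, mul_add]; abel))
    (fun s X Y => Subtype.ext (by
      simp only [Submodule.coe_smul, Matrix.smul_mul, Matrix.mul_smul, ← smul_sub]))

end OctonionMatrices

/-!
Hermitian matrices form a unital algebra, so evaluating the Leibniz rule at the unit gives `δ = 1`,
or `δ = 1 / 2` and `D` is multiplication by `D 1`. In the latter case the diagonal idempotents force
`D 1` to be diagonal with real entries, and the off-diagonal units force these entries to be equal.

For skew-Hermitian matrices and `δ ≠ 1`, let `x e_ii` be a diagonal matrix with an imaginary entry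
`x`. Its image is concentrated in place `(i, i)`: the places outside row and column `i` vanish since
the commutator algebra of the imaginary octonions is perfect, the remaining ones since `x e_ii`
commutes with every `y e_jj`. The `(i, i)` entry is a `δ`-derivation of the imaginary octonions.
Any three octonions behaving like `i`, `j`, `ℓ` give relations between the values of the trace form
on its images, which show that it is multiplication by some `t` with `(2 * δ - 1) * t = 0`. For such
a `t` the Leibniz rule makes `D - t` a twisted module map, and this determines `D` on the
off-diagonal places as well. Hence `D = t` and, as `D ≠ 0`, `δ = 1 / 2`.
-/

namespace Octonion

variable {K : Type*} [Field K] {a b c : K}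

/-- The first quaternion generator, with `genI * genI = a • 1`. -/
def genI : Octonion a b c := ⟨⟨0, 1, 0, 0⟩, 0⟩

/-- The second quaternion generator, with `genJ * genJ = b • 1`. -/
def genJ : Octonion a b c := ⟨⟨0, 0, 1, 0⟩, 0⟩

/-- The doubling generator `ℓ`, with `genL * genL = c • 1`. -/
def genL : Octonion a b c := ⟨0, ⟨1, 0, 0, 0⟩⟩

@[simp] theorem fst_genI : (genI : Octonion a b c).fst = ⟨0, 1, 0, 0⟩ := rfl
@[simp] theorem snd_genI : (genI : Octonion a b c).snd = 0 := rfl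
@[simp] theorem fst_genJ : (genJ : Octonion a b c).fst = ⟨0, 0, 1, 0⟩ := rfl
@[simp] theorem snd_genJ : (genJ : Octonion a b c).snd = 0 := rfl
@[simp] theorem fst_genL : (genL : Octonion a b c).fst = 0 := rfl
@[simp] theorem snd_genL : (genL : Octonion a b c).snd = ⟨1, 0, 0, 0⟩ := rfl

theorem star_genI : star (genI : Octonion a b c) = -genI := by ext <;> simp

theorem star_genJ : star (genJ : Octonion a b c) = -genJ := by ext <;> simp

theorem star_genL : star (genL : Octonion a b c) = -genL := by ext <;> simp

theorem genI_mul_self : (genI * genI : Octonion a b c) = a • 1 := by ext <;> simp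

theorem genJ_mul_genI : (genJ * genI : Octonion a b c) = -(genI * genJ) := by ext <;> simp

/-- The real part of an octonion, as a linear form. The symmetric bilinear form `re (x * y)` is the
trace form of the octonion algebra. -/
def re : Octonion a b c →ₗ[K] K where
  toFun x := x.fst.re
  map_add' _ _ := rfl
  map_smul' _ _ := rfl

@[simp] theorem re_apply (x : Octonion a b c) : re x = x.fst.re := rfl

set_option maxHeartbeats 1000000 in
-- eight cubic polynomial identities in sixteen coordinates
theorem mul_mul_self (x y : Octonion a b c) : x * (x * y) = (x * x) * y := by
  ext <;> simp <;> ring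

theorem mul_self_mul (x y : Octonion a b c) : (y * x) * x = y * (x * x) := by
  have h := congrArg star (mul_mul_self (star x) (star y))
  simpa only [star_mul, star_star] using h

theorem mul_mul_add_mul_mul (x y z : Octonion a b c) :
    x * (y * z) + y * (x * z) = (x * y + y * x) * z := by
  have hadd := mul_mul_self (x + y) z
  simp only [add_mul, mul_add, mul_mul_self] at hadd
  rw [add_mul]
  linear_combination (norm := module) hadd

theorem mul_mul_add_mul_mul_right (x y z : Octonion a b c) :
    (z * y) * x + (z * x) * y = z * (y * x + x * y) := by
  have h := congrArg star (mul_mul_add_mul_mul (star x) (star y) (star z))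
  simpa only [star_add, star_mul, star_star] using h

theorem mul_mul_flexible (x y : Octonion a b c) : x * (y * x) = (x * y) * x := by
  have h := mul_mul_add_mul_mul x y x
  rwa [add_mul, mul_self_mul, add_left_inj] at h

theorem mul_mul_of_anticomm {x y : Octonion a b c} (h : y * x = -(x * y)) (z : Octonion a b c) :
    x * (y * z) = -(y * (x * z)) := by
  rw [eq_neg_iff_add_eq_zero, mul_mul_add_mul_mul, h, add_neg_cancel, zero_mul]

theorem re_mul_comm (x y : Octonion a b c) : re (x * y) = re (y * x) := by
  simp; ring

theorem re_mul_assoc (x y z : Octonion a b c) : re ((x * y) * z) = re (x * (y * z)) := by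
  simp; ring

theorem re_commutator_mul (x y z : Octonion a b c) :
    re ((x * y - y * x) * z) = re (x * (y * z - z * y)) := by
  rw [sub_mul, mul_sub, map_sub, map_sub, re_mul_assoc, re_mul_assoc, re_mul_comm y, re_mul_assoc]

theorem star_eq_smul_one_sub (x : Octonion a b c) : star x = (2 * re x) • 1 - x := by
  ext <;> simp
  ring

section Imaginary

variable {x y z : Octonion a b c}

theorem star_commutator (hx : star x = -x) (hy : star y = -y) :
    star (x * y - y * x) = -(x * y - y * x) := by
  rw [star_sub, star_mul, star_mul, hx, hy, neg_mul_neg, neg_mul_neg, neg_sub]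

theorem star_mul_of_anticomm (hx : star x = -x) (hy : star y = -y) (h : y * x = -(x * y)) :
    star (x * y) = -(x * y) := by
  rw [star_mul, hx, hy, neg_mul_neg, h]

theorem mul_eq_star_mul_add (hx : star x = -x) (y : Octonion a b c) :
    x * y = star y * x + (2 * re (x * y)) • 1 := by
  have hstar := star_eq_smul_one_sub (x * y)
  rw [star_mul, hx, mul_neg] at hstar
  linear_combination (norm := module) hstar

variable [NeZero (2 : K)]

variable (K) in
theorem eq_zero_of_eq_neg {V : Type*} [AddCommGroup V] [Module K V] {v : V} (h : v = -v) :
    v = 0 :=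
  (smul_eq_zero_iff_right (two_ne_zero (α := K))).1 (by
    rw [two_smul, ← eq_neg_iff_add_eq_zero, ← h])

theorem re_eq_zero (hx : star x = -x) : x.fst.re = 0 :=
  eq_zero_of_eq_neg K (by simpa using congrArg re hx)

theorem eq_sum_gen_of_star_eq_neg (hx : star x = -x) :
    x = x.fst.imI • genI + x.fst.imJ • genJ + x.fst.imK • (genI * genJ) + x.snd.re • genL
      + x.snd.imI • (genI * genL) + x.snd.imJ • (genJ * genL)
      + x.snd.imK • ((genI * genJ) * genL) := by
  ext <;> simp [re_eq_zero hx]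

theorem eq_re_smul_one_of_star_eq (hx : star x = x) : x = re x • 1 := by
  have hneg (u : K) (hu : -u = u) : u = 0 := eq_zero_of_eq_neg K hu.symm
  simp only [Octonion.ext_iff, QuaternionAlgebra.ext_iff] at hx
  ext <;> simp_all

theorem mul_self_eq_re_smul_one (hx : star x = -x) : x * x = re (x * x) • 1 :=
  eq_re_smul_one_of_star_eq (by rw [star_mul, hx, neg_mul_neg])

theorem mul_mul_self_of_star_eq_neg (hx : star x = -x) (y : Octonion a b c) :
    x * (x * y) = re (x * x) • y := by
  rw [mul_mul_self, mul_self_eq_re_smul_one hx, smul_one_mul, ← mul_self_eq_re_smul_one hx]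

theorem mul_self_mul_of_star_eq_neg (hx : star x = -x) (y : Octonion a b c) :
    (y * x) * x = re (x * x) • y := by
  rw [mul_self_mul, mul_self_eq_re_smul_one hx, mul_smul_one, ← mul_self_eq_re_smul_one hx]

theorem mul_mul_eq_of_star_eq_neg (hx : star x = -x) (y : Octonion a b c) :
    (x * y) * x = re (x * x) • star y + (2 * re (x * y)) • x := by
  conv_lhs => rw [mul_eq_star_mul_add hx y]
  rw [add_mul, mul_self_mul_of_star_eq_neg hx, smul_one_mul]

theorem commutator_commutator (hx : star x = -x) (hy : star y = -y) :
    x * (x * y - y * x) - (x * y - y * x) * x =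
      (4 * re (x * x)) • y - (4 * re (x * y)) • x := by
  rw [mul_sub, sub_mul, mul_mul_flexible, mul_mul_self_of_star_eq_neg hx,
    mul_self_mul_of_star_eq_neg hx, mul_mul_eq_of_star_eq_neg hx, hy]
  module

theorem mul_mul_mul_self_right (hx : star x = -x) (y z : Octonion a b c) :
    ((z * x) * y) * x = z * ((x * y) * x) := by
  have hanti : y * x + x * y = (2 * re y) • x + (2 * re (x * y)) • 1 := by
    conv_lhs => rw [mul_eq_star_mul_add hx y, star_eq_smul_one_sub y, sub_mul, smul_one_mul]
    abel
  have hlin := mul_mul_add_mul_mul_right x y (z * x)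
  rw [hanti, mul_self_mul_of_star_eq_neg hx, mul_add, mul_smul_comm, mul_smul_comm, mul_one,
    mul_self_mul_of_star_eq_neg hx, smul_mul_assoc] at hlin
  rw [mul_mul_eq_of_star_eq_neg hx, star_eq_smul_one_sub, mul_add, mul_smul_comm, mul_smul_comm,
    mul_sub, mul_smul_one]
  linear_combination (norm := module) hlin

theorem mul_mul_of_anticomm_self (hx : star x = -x) (h : y * x = -(x * y)) :
    (x * y) * x = -(re (x * x) • y) := by
  rw [← mul_self_mul_of_star_eq_neg hx, h, neg_mul, neg_neg]

theorem anticomm_of_re_mul_eq_zero (hx : star x = -x) (hy : star y = -y) (h : re (x * y) = 0) :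
    y * x = -(x * y) := by
  rw [eq_neg_iff_add_eq_zero, eq_re_smul_one_of_star_eq (x := y * x + x * y)
    (by rw [star_add, star_mul, star_mul, hx, hy, neg_mul_neg, neg_mul_neg, add_comm]),
    map_add, re_mul_comm y, h, add_zero, zero_smul]

theorem re_mul_eq_zero_of_anticomm (h : y * x = -(x * y)) : re (y * x) = 0 :=
  eq_zero_of_eq_neg K (by conv_lhs => rw [h, map_neg, re_mul_comm])

theorem mul_mul_of_re_mul_eq_zero (hx : star x = -x) (hy : star y = -y) (hz : star z = -z)
    (hyx : y * x = -(x * y)) (hzx : re (z * x) = 0) (hzy : re (z * y) = 0)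
    (hzxy : re (z * (x * y)) = 0) : x * (y * z) = -((x * y) * z) := by
  have hxz : z * x = -(x * z) := by rw [anticomm_of_re_mul_eq_zero hz hx hzx, neg_neg]
  rw [anticomm_of_re_mul_eq_zero hz hy hzy, mul_neg, mul_mul_of_anticomm hxz y, neg_neg,
    anticomm_of_re_mul_eq_zero hz (star_mul_of_anticomm hx hy hyx) hzxy, neg_neg]

theorem mul_mul_eq_neg_of_anticomm (hx : star x = -x) (h : x * y = -(y * x)) :
    x * (y * x) = -((y * x) * x) := by
  rw [mul_self_mul_of_star_eq_neg hx, ← mul_mul_self_of_star_eq_neg hx, h, mul_neg, neg_neg]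

theorem eq_zero_of_mul_eq_zero_left (hx : star x = -x) (hxx : re (x * x) ≠ 0) (h : x * y = 0) :
    y = 0 := by
  have hxxy := mul_mul_self_of_star_eq_neg hx y
  rw [h, mul_zero] at hxxy
  exact (smul_eq_zero_iff_right hxx).1 hxxy.symm

theorem eq_zero_of_mul_eq_zero_right (hx : star x = -x) (hxx : re (x * x) ≠ 0) (h : y * x = 0) :
    y = 0 := by
  have hyxx := mul_self_mul_of_star_eq_neg hx y
  rw [h, zero_mul] at hyxx
  exact (smul_eq_zero_iff_right hxx).1 hyxx.symm

theorem re_mul_mul_self_of_anticomm (hx : star x = -x) (h : y * x = -(x * y)) :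
    re ((x * y) * (x * y)) = -(re (x * x) * re (y * y)) := by
  rw [← re_mul_assoc, mul_mul_of_anticomm_self hx h, neg_mul, smul_mul_assoc, map_neg, map_smul,
    smul_eq_mul]

end Imaginary

/-- A Cayley triple: three pairwise anticommuting, nonisotropic imaginary octonions, the third of
which also anticommutes with the product of the first two. Such a triple plays the role of the
standard one `genI, genJ, genL`, and having many of them avoids most coordinate computations. -/
structure IsCayleyTriple (x y z : Octonion a b c) : Prop where
  star_fst : star x = -x
  star_snd : star y = -y
  star_trd : star z = -z
  snd_mul_fst : y * x = -(x * y)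
  trd_mul_fst : z * x = -(x * z)
  trd_mul_snd : z * y = -(y * z)
  trd_mul_mul : z * (x * y) = -((x * y) * z)
  re_fst : re (x * x) ≠ 0
  re_snd : re (y * y) ≠ 0
  re_trd : re (z * z) ≠ 0

theorem isCayleyTriple_gen (ha : a ≠ 0) (hb : b ≠ 0) (hc : c ≠ 0) :
    IsCayleyTriple (genI : Octonion a b c) genJ genL where
  star_fst := star_genI
  star_snd := star_genJ
  star_trd := star_genL
  snd_mul_fst := genJ_mul_genI
  trd_mul_fst := by ext <;> simp
  trd_mul_snd := by ext <;> simp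
  trd_mul_mul := by ext <;> simp
  re_fst := by simpa using ha
  re_snd := by simpa using hb
  re_trd := by simpa using hc

namespace IsCayleyTriple

variable {x y z : Octonion a b c}

theorem mul_mul (h : IsCayleyTriple x y z) : x * (y * z) = -((x * y) * z) := by
  have hxzy := mul_mul_of_anticomm h.trd_mul_fst y
  rwa [h.trd_mul_snd, mul_neg, neg_inj, h.trd_mul_mul] at hxzy

theorem mul_mul_fst (h : IsCayleyTriple x y z) : (y * z) * x = -(x * (y * z)) := by
  calc (y * z) * x = star (x * (y * z)) := by
        rw [star_mul, star_mul, h.star_fst, h.star_snd, h.star_trd, neg_mul_neg, mul_neg,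
          h.trd_mul_snd, neg_mul, neg_neg]
    _ = -(z * (x * y)) := by
        rw [h.mul_mul, star_neg, star_mul, star_mul, h.star_fst, h.star_snd, h.star_trd,
          neg_mul_neg, neg_mul, neg_neg, h.snd_mul_fst, mul_neg]
    _ = -(x * (y * z)) := by rw [h.trd_mul_mul, h.mul_mul]

theorem swap (h : IsCayleyTriple x y z) : IsCayleyTriple y x z where
  star_fst := h.star_snd
  star_snd := h.star_fst
  star_trd := h.star_trd
  snd_mul_fst := by rw [h.snd_mul_fst, neg_neg]
  trd_mul_fst := h.trd_mul_snd
  trd_mul_snd := h.trd_mul_fst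
  trd_mul_mul := by rw [h.snd_mul_fst, mul_neg, h.trd_mul_mul, neg_mul]
  re_fst := h.re_snd
  re_snd := h.re_fst
  re_trd := h.re_trd

theorem rotate (h : IsCayleyTriple x y z) : IsCayleyTriple y z x where
  star_fst := h.star_snd
  star_snd := h.star_trd
  star_trd := h.star_fst
  snd_mul_fst := h.trd_mul_snd
  trd_mul_fst := by rw [h.snd_mul_fst, neg_neg]
  trd_mul_snd := by rw [h.trd_mul_fst, neg_neg]
  trd_mul_mul := by rw [h.mul_mul_fst, neg_neg]
  re_fst := h.re_snd
  re_snd := h.re_trd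
  re_trd := h.re_fst

variable [NeZero (2 : K)]

theorem re_mul_ne_zero (h : IsCayleyTriple x y z) : re ((x * y) * (x * y)) ≠ 0 := by
  rw [re_mul_mul_self_of_anticomm h.star_fst h.snd_mul_fst]
  exact neg_ne_zero.2 (mul_ne_zero h.re_fst h.re_snd)

theorem mul_snd (h : IsCayleyTriple x y z) : IsCayleyTriple x (x * y) z where
  star_fst := h.star_fst
  star_snd := star_mul_of_anticomm h.star_fst h.star_snd h.snd_mul_fst
  star_trd := h.star_trd
  snd_mul_fst := by
    rw [mul_mul_of_anticomm_self h.star_fst h.snd_mul_fst, mul_mul_self_of_star_eq_neg h.star_fst]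
  trd_mul_fst := h.trd_mul_fst
  trd_mul_snd := h.trd_mul_mul
  trd_mul_mul := by
    rw [mul_mul_self_of_star_eq_neg h.star_fst, mul_smul_comm, h.trd_mul_snd, smul_neg,
      smul_mul_assoc]
  re_fst := h.re_fst
  re_snd := h.re_mul_ne_zero
  re_trd := h.re_trd

theorem mul_trd (h : IsCayleyTriple x y z) : IsCayleyTriple x (y * z) z where
  star_fst := h.star_fst
  star_snd := h.rotate.mul_snd.star_snd
  star_trd := h.star_trd
  snd_mul_fst := h.mul_mul_fst
  trd_mul_fst := h.trd_mul_fst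
  trd_mul_snd := mul_mul_eq_neg_of_anticomm h.star_trd h.trd_mul_snd
  trd_mul_mul := by
    rw [h.mul_mul, mul_neg, mul_mul_eq_neg_of_anticomm h.star_trd h.trd_mul_mul, neg_mul]
  re_fst := h.re_fst
  re_snd := h.rotate.re_mul_ne_zero
  re_trd := h.re_trd

theorem eq_zero_of_re_mul_eq_zero (h : IsCayleyTriple x y z) {w : Octonion a b c}
    (hw : star w = -w) (hx : re (w * x) = 0) (hy : re (w * y) = 0) (hz : re (w * z) = 0)
    (hxy : re (w * (x * y)) = 0) (hxz : re (w * (x * z)) = 0) (hyz : re (w * (y * z)) = 0)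
    (hxyz : re (w * ((x * y) * z)) = 0) : w = 0 := by
  have star_xy := h.mul_snd.star_snd
  have star_zw : star (z * w) = -(z * w) :=
    star_mul_of_anticomm h.star_trd hw
      (by rw [anticomm_of_re_mul_eq_zero hw h.star_trd hz, neg_neg])
  have re_zw (v : Octonion a b c) : re ((z * w) * v) = re (w * (v * z)) := by
    rw [re_mul_assoc, re_mul_comm, re_mul_assoc]
  have assoc_zw : x * (y * (z * w)) = -((x * y) * (z * w)) :=
    mul_mul_of_re_mul_eq_zero h.star_fst h.star_snd star_zw h.snd_mul_fst (by rw [re_zw, hxz])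
      (by rw [re_zw, hyz]) (by rw [re_zw, hxyz])
  have assoc_w : x * (y * (z * w)) = (x * y) * (z * w) :=
    calc x * (y * (z * w)) = -(x * ((y * z) * w)) := by
          rw [mul_mul_of_re_mul_eq_zero h.star_snd h.star_trd hw h.trd_mul_snd hy hz hyz, mul_neg]
      _ = (x * (y * z)) * w := by
          rw [mul_mul_of_re_mul_eq_zero h.star_fst h.mul_trd.star_snd hw h.mul_mul_fst hx hyz
            (by rw [h.mul_mul, mul_neg, map_neg, hxyz, neg_zero]), neg_neg]
      _ = (x * y) * (z * w) := by
          rw [mul_mul_of_re_mul_eq_zero star_xy h.star_trd hw h.trd_mul_mul hxy hz hxyz, h.mul_mul,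
            neg_mul]
  have hzero : (x * y) * (z * w) = 0 := eq_zero_of_eq_neg K (assoc_w.symm.trans assoc_zw)
  have hzw : z * w = 0 := eq_zero_of_mul_eq_zero_left star_xy h.re_mul_ne_zero hzero
  exact eq_zero_of_mul_eq_zero_left h.star_trd h.re_trd hzw

end IsCayleyTriple

/-- A linear map preserving the imaginary octonions and satisfying the Leibniz rule of a
`δ`-derivation for their commutator product. The diagonal entries of a `δ`-derivation of the
skew-Hermitian matrices are of this form. -/
structure IsImaginaryDeltaDerivation (δ : K) (F : Octonion a b c →ₗ[K] Octonion a b c) :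
    Prop where
  star_map {x : Octonion a b c} : star x = -x → star (F x) = -F x
  map_commutator {x y : Octonion a b c} : star x = -x → star y = -y →
    F (x * y - y * x) = δ • (F x * y - y * F x) + δ • (x * F y - F y * x)

namespace IsImaginaryDeltaDerivation

variable {δ : K} {F : Octonion a b c →ₗ[K] Octonion a b c} {x y z : Octonion a b c}

theorem re_map_commutator_mul (hF : IsImaginaryDeltaDerivation δ F) (hx : star x = -x)
    (hy : star y = -y) (w : Octonion a b c) :
    re (F (x * y - y * x) * w) =
      δ * re (F x * (y * w - w * y)) - δ * re (F y * (x * w - w * x)) := by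
  rw [hF.map_commutator hx hy, add_mul, map_add, smul_mul_assoc, smul_mul_assoc, map_smul,
    map_smul, re_commutator_mul, ← neg_sub (F y * x), neg_mul, map_neg, re_commutator_mul,
    smul_eq_mul, smul_eq_mul]
  ring

variable [NeZero (2 : K)]

theorem re_map_mul_of_anticomm (hF : IsImaginaryDeltaDerivation δ F) (hx : star x = -x)
    (hy : star y = -y) (hxx : re (x * x) ≠ 0) (h : y * x = -(x * y)) :
    re (F y * x) = -δ * re (F x * y) := by
  have hcomm := hF.re_map_commutator_mul hx (star_mul_of_anticomm hx hy h) x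
  rw [mul_mul_of_anticomm_self hx h, mul_mul_self_of_star_eq_neg hx, sub_self, mul_zero, map_zero,
    ← sub_eq_zero] at hcomm
  simp only [sub_neg_eq_add, neg_sub_left, map_add, map_neg, map_smul, add_mul, mul_add, mul_neg,
    smul_mul_assoc, mul_smul_comm, smul_eq_mul] at hcomm
  refine mul_left_cancel₀ (mul_ne_zero two_ne_zero hxx) ?_
  linear_combination hcomm

theorem re_map_mul_mul (hF : IsImaginaryDeltaDerivation δ F) (h : IsCayleyTriple x y z) :
    re (F (x * z) * (y * z)) =
      -δ * re (z * z) * re (F x * y) + δ * re (F z * ((x * y) * z)) := by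
  have hcomm := hF.re_map_commutator_mul h.star_fst h.star_trd (y * z)
  have hz : z * (y * z) = -(re (z * z) • y) := by
    rw [mul_mul_eq_neg_of_anticomm h.star_trd h.trd_mul_snd, mul_self_mul_of_star_eq_neg h.star_trd]
  rw [h.trd_mul_fst, hz, mul_self_mul_of_star_eq_neg h.star_trd, h.mul_mul_fst, h.mul_mul] at hcomm
  simp only [sub_neg_eq_add, map_add, map_neg, map_sub, map_smul, add_mul, mul_neg,
    mul_sub, neg_neg, mul_smul_comm, smul_eq_mul] at hcomm
  refine mul_left_cancel₀ (two_ne_zero (α := K)) ?_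
  linear_combination hcomm

theorem re_map_trd_mul_mul (hF : IsImaginaryDeltaDerivation δ F) (hδ0 : δ ≠ 0) (hδ1 : δ ≠ 1)
    (h : IsCayleyTriple x y z) : re (F z * ((x * y) * z)) = 0 := by
  have hxy := hF.re_map_mul_of_anticomm h.star_fst h.star_snd h.re_fst h.snd_mul_fst
  have hxzyz := hF.re_map_mul_mul h
  have hyzxz := hF.re_map_mul_mul h.swap
  have hswap : re (F (y * z) * (x * z)) = -δ * re (F (x * z) * (y * z)) :=
    hF.re_map_mul_of_anticomm h.swap.rotate.mul_snd.star_snd h.rotate.mul_snd.star_snd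
      h.swap.rotate.re_mul_ne_zero h.mul_trd.rotate.rotate.swap.trd_mul_mul
  rw [h.snd_mul_fst, neg_mul _ z, mul_neg (F z), map_neg] at hyzxz
  refine (mul_eq_zero.1 ?_).resolve_left (mul_ne_zero hδ0 (sub_ne_zero.2 hδ1.symm))
  linear_combination hyzxz - hswap + δ * hxzyz - δ * re (z * z) * hxy

theorem re_map_trd_mul_fst (hF : IsImaginaryDeltaDerivation δ F) (hδ0 : δ ≠ 0) (hδ1 : δ ≠ 1)
    (h : IsCayleyTriple x y z) : re (F z * x) = 0 := by
  have hx : (y * ((y * x) * z)) * z = -((re (z * z) * re (y * y)) • x) := by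
    rw [h.swap.mul_snd.mul_mul, neg_mul, mul_self_mul_of_star_eq_neg h.star_trd,
      mul_mul_self_of_star_eq_neg h.star_snd, smul_smul]
  have hzero := hF.re_map_trd_mul_mul hδ0 hδ1 h.swap.mul_snd.mul_trd
  rw [hx, mul_neg, map_neg, neg_eq_zero, mul_smul_comm, map_smul, smul_eq_mul] at hzero
  exact (mul_eq_zero.1 hzero).resolve_left (mul_ne_zero h.re_trd h.re_snd)

theorem map_mul (hF : IsImaginaryDeltaDerivation δ F) {s t : K} (hx : star x = -x)
    (hy : star y = -y) (h : y * x = -(x * y)) (hs : F x = s • x) (ht : F y = t • y) :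
    F (x * y) = (δ * (s + t)) • (x * y) := by
  have hcomm := hF.map_commutator hx hy
  simp only [hs, ht, smul_mul_assoc, mul_smul_comm, h, sub_neg_eq_add, ← two_smul K (x * y),
    map_smul] at hcomm
  refine smul_right_injective _ (two_ne_zero (α := K)) ?_
  simp only [hcomm]
  module

theorem eigenvalue_fst_eq_trd (hF : IsImaginaryDeltaDerivation δ F) (hδ0 : δ ≠ 0) (hδ1 : δ ≠ 1)
    (h : IsCayleyTriple x y z) {r s t : K} (hr : F x = r • x) (hs : F y = s • y)
    (ht : F z = t • z) : r = t := by
  have hxy := hF.map_mul h.star_fst h.star_snd h.snd_mul_fst hr hs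
  have hyz := hF.map_mul h.star_snd h.star_trd h.trd_mul_snd hs ht
  have hxyz := hF.map_mul h.mul_snd.star_snd h.star_trd h.trd_mul_mul hxy ht
  have hassoc := hF.map_mul h.star_fst h.mul_trd.star_snd h.mul_mul_fst hr hyz
  rw [h.mul_mul, map_neg, hxyz, smul_neg, neg_inj] at hassoc
  have h0 : (x * y) * z ≠ 0 := fun h0 =>
    h.mul_snd.rotate.re_mul_ne_zero (by rw [h0, zero_mul, map_zero])
  have heq := smul_left_injective K h0 hassoc
  refine mul_left_cancel₀ (mul_ne_zero hδ0 (sub_ne_zero.2 hδ1.symm)) ?_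
  linear_combination -heq

theorem exists_map_trd (hF : IsImaginaryDeltaDerivation δ F) (hδ0 : δ ≠ 0) (hδ1 : δ ≠ 1)
    (h : IsCayleyTriple x y z) : ∃ t : K, F z = t • z := by
  set t : K := re (F z * z) / re (z * z) with ht
  have orthogonal {v w : Octonion a b c} (hv : IsCayleyTriple v w z) :
      re ((F z - t • z) * v) = 0 := by
    rw [sub_mul, map_sub, hF.re_map_trd_mul_fst hδ0 hδ1 hv, smul_mul_assoc, map_smul,
      re_mul_eq_zero_of_anticomm hv.trd_mul_fst, smul_zero, sub_zero]
  have orthogonal_trd : re ((F z - t • z) * z) = 0 := by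
    rw [sub_mul, map_sub, smul_mul_assoc, map_smul, smul_eq_mul, ht, div_mul_cancel₀ _ h.re_trd,
      sub_self]
  have star_sub : star (F z - t • z) = -(F z - t • z) := by
    rw [star_sub, star_smul', hF.star_map h.star_trd, h.star_trd, smul_neg, neg_sub_neg, neg_sub]
  exact ⟨t, sub_eq_zero.1 <| h.eq_zero_of_re_mul_eq_zero star_sub (orthogonal h)
    (orthogonal h.swap) orthogonal_trd (orthogonal h.mul_snd.swap) (orthogonal h.swap.mul_trd.swap)
    (orthogonal h.mul_trd.swap) (orthogonal h.mul_snd.mul_trd.swap)⟩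

theorem exists_eigenvalue (ha : a ≠ 0) (hb : b ≠ 0) (hc : c ≠ 0) (hδ0 : δ ≠ 0) (hδ1 : δ ≠ 1)
    (hF : IsImaginaryDeltaDerivation δ F) :
    ∃ t : K, (2 * δ - 1) * t = 0 ∧ F genI = t • genI ∧ F genJ = t • genJ ∧ F genL = t • genL := by
  have h := isCayleyTriple_gen ha hb hc
  obtain ⟨r, hr⟩ := hF.exists_map_trd hδ0 hδ1 h.rotate
  obtain ⟨s, hs⟩ := hF.exists_map_trd hδ0 hδ1 h.rotate.rotate
  obtain ⟨t, ht⟩ := hF.exists_map_trd hδ0 hδ1 h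
  have hJI := hF.map_mul star_genJ star_genI h.swap.snd_mul_fst hs hr
  obtain rfl := hF.eigenvalue_fst_eq_trd hδ0 hδ1 h hr hs ht
  obtain rfl := hF.eigenvalue_fst_eq_trd hδ0 hδ1 h.swap hs hr ht
  have hδs := hF.eigenvalue_fst_eq_trd hδ0 hδ1 h.swap.mul_snd.swap hJI hs ht
  exact ⟨s, by linear_combination hδs, hr, hs, ht⟩

theorem eq_smul (ha : a ≠ 0) (hb : b ≠ 0) (hc : c ≠ 0) (hδ0 : δ ≠ 0) (hδ1 : δ ≠ 1)
    (hF : IsImaginaryDeltaDerivation δ F) :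
    ∃ t : K, (2 * δ - 1) * t = 0 ∧ ∀ x, star x = -x → F x = t • x := by
  obtain ⟨t, hδt, hI, hJ, hL⟩ := hF.exists_eigenvalue ha hb hc hδ0 hδ1
  refine ⟨t, hδt, fun x hx => ?_⟩
  have hmul {x y : Octonion a b c} (hx : star x = -x) (hy : star y = -y) (h : y * x = -(x * y))
      (hFx : F x = t • x) (hFy : F y = t • y) : F (x * y) = t • (x * y) := by
    rw [hF.map_mul hx hy h hFx hFy, show δ * (t + t) = t by linear_combination hδt]
  have h := isCayleyTriple_gen ha hb hc
  have hIJ := hmul star_genI star_genJ h.snd_mul_fst hI hJ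
  rw [eq_sum_gen_of_star_eq_neg hx]
  simp only [map_add, map_smul, smul_add, smul_comm t, hI, hJ, hL, hIJ,
    hmul star_genI star_genL h.trd_mul_fst hI hL, hmul star_genJ star_genL h.trd_mul_snd hJ hL,
    hmul h.mul_snd.star_snd star_genL h.trd_mul_mul hIJ hL]

end IsImaginaryDeltaDerivation

variable [NeZero (2 : K)] {δ : K}

theorem map_eq_zero_of_map_commutator {V : Type*} [AddCommGroup V] [Module K V] (ha : a ≠ 0)
    (hb : b ≠ 0) (φ : Octonion a b c →ₗ[K] V)
    (hφ : ∀ x y, star x = -x → star y = -y → φ (x * y - y * x) = 0)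
    {x : Octonion a b c} (hx : star x = -x) : φ x = 0 := by
  have h4 : (4 : K) ≠ 0 := by
    simpa only [show (2 : K) * 2 = 4 by norm_num] using mul_self_ne_zero.2 (two_ne_zero (α := K))
  have hsmul {u v : Octonion a b c} (hu : star u = -u) (hv : star v = -v) :
      (4 * re (u * u)) • φ v = (4 * re (u * v)) • φ u := by
    rw [← sub_eq_zero, ← map_smul, ← map_smul, ← map_sub, ← commutator_commutator hu hv]
    exact hφ _ _ hu (star_commutator hu hv)
  have hI : φ genI = 0 := by
    have h := hsmul star_genJ star_genI
    rw [re_mul_eq_zero_of_anticomm genJ_mul_genI, mul_zero, zero_smul] at h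
    exact (smul_eq_zero_iff_right (mul_ne_zero h4 (by simpa using hb))).1 h
  have h := hsmul star_genI hx
  rw [hI, smul_zero] at h
  exact (smul_eq_zero_iff_right (mul_ne_zero h4 (by simpa using ha))).1 h

/-- Left multiplication by `x * y` and left multiplication by `y` followed by that by `x` are
commuting operators with the same nonzero scalar square. -/
theorem eq_zero_of_smul_mul_mul_eq {x y q : Octonion a b c} {r s : K} (hx : star x = -x)
    (hy : star y = -y) (hyx : y * x = -(x * y)) (hxx : re (x * x) ≠ 0) (hyy : re (y * y) ≠ 0)
    (hrs : r ^ 2 ≠ s ^ 2) (h : r • ((x * y) * q) = s • (x * (y * q))) : q = 0 := by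
  have sq_left : (x * y) * ((x * y) * q) = -(re (x * x) * re (y * y)) • q := by
    rw [mul_mul_self_of_star_eq_neg (star_mul_of_anticomm hx hy hyx),
      re_mul_mul_self_of_anticomm hx hyx]
  have sq_right : x * (y * (x * (y * q))) = -(re (x * x) * re (y * y)) • q := by
    rw [mul_mul_of_anticomm (x := y) (by rw [hyx, neg_neg]), mul_neg,
      mul_mul_self_of_star_eq_neg hx, mul_mul_self_of_star_eq_neg hy, smul_smul, neg_smul]
  have hxy : (x * y) * (x * (y * q)) = x * (y * ((x * y) * q)) := by
    rw [mul_mul_of_anticomm (x := x * y) (y := x)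
        (by rw [mul_mul_of_anticomm_self hx hyx, mul_mul_self_of_star_eq_neg hx, neg_neg]),
      mul_mul_of_anticomm (x := x * y) (y := y) (mul_mul_eq_neg_of_anticomm hy hyx), mul_neg,
      neg_neg]
  have hr := congrArg (fun u => (x * y) * (r • u)) h
  have hs := congrArg (fun u => x * (y * (s • u))) h
  simp only [mul_smul_comm, sq_left, sq_right, hxy] at hr hs
  have hzero : (-(re (x * x) * re (y * y)) * (r ^ 2 - s ^ 2)) • q = 0 := by
    linear_combination (norm := module) hr + hs
  exact (smul_eq_zero_iff_right
    (mul_ne_zero (neg_ne_zero.2 (mul_ne_zero hxx hyy)) (sub_ne_zero.2 hrs))).1 hzero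

theorem eq_zero_of_commutator_mul_mul {x y q : Octonion a b c} (hx : star x = -x)
    (hy : star y = -y) (hyx : y * x = -(x * y)) (hxx : re (x * x) ≠ 0) (hyy : re (y * y) ≠ 0)
    (hδ : δ ≠ 1)
    (h : ((x * y - y * x) * q) * x = δ • (x * ((y * q) * x) - y * ((x * q) * x))) : q = 0 := by
  have hmul : (((2 - δ) • ((x * y) * q)) - δ • (x * (y * q))) * x = 0 := by
    rw [mul_mul_flexible, ← mul_mul_mul_self_right hx, hyx] at h
    simp only [sub_neg_eq_add, add_mul, neg_mul, sub_mul, smul_mul_assoc] at h ⊢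
    linear_combination (norm := module) h
  refine eq_zero_of_smul_mul_mul_eq hx hy hyx hxx hyy (r := 2 - δ) (s := δ) (fun hsq => hδ ?_)
    (sub_eq_zero.1 (eq_zero_of_mul_eq_zero_right hx hxx hmul))
  have h4 : (2 : K) * (2 * (1 - δ)) = 0 := by linear_combination hsq
  rw [mul_eq_zero_iff_left two_ne_zero, mul_eq_zero_iff_left two_ne_zero] at h4
  exact (sub_eq_zero.1 h4).symm

theorem map_eq_zero_of_intertwining (ha : a ≠ 0) (hb : b ≠ 0) (hδ : δ ≠ 1)
    (φ ψ : Octonion a b c →ₗ[K] Octonion a b c)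
    (h : ∀ x y, star x = -x → star y = -y → φ x * y + x * ψ y = 0)
    (hφ : ∀ x y, star x = -x → star y = -y → φ (x * y - y * x) = δ • (x * φ y - y * φ x))
    {x : Octonion a b c} (hx : star x = -x) : φ x = 0 := by
  have smul_map {v : Octonion a b c} (hv : star v = -v) : a • φ v = -((v * ψ genI) * genI) := by
    have hv := congrArg (· * genI) (h v genI hv star_genI)
    simp only [add_mul, mul_self_mul, genI_mul_self, mul_smul_comm, mul_one, zero_mul] at hv
    exact eq_neg_of_add_eq_zero_left hv
  have hψ : ψ genI = 0 := by
    refine eq_zero_of_commutator_mul_mul star_genI star_genJ genJ_mul_genI (by simpa using ha)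
      (by simpa using hb) hδ (neg_injective ?_)
    rw [← smul_map (star_commutator star_genI star_genJ), hφ _ _ star_genI star_genJ, smul_comm,
      smul_sub, ← mul_smul_comm, ← mul_smul_comm, smul_map star_genI, smul_map star_genJ]
    simp only [mul_neg, smul_sub, smul_neg]
    abel
  have hzero := smul_map hx
  rw [hψ, mul_zero, zero_mul, neg_zero] at hzero
  exact (smul_eq_zero_iff_right ha).1 hzero

theorem eq_re_smul_one_of_commute (ha : a ≠ 0) {q : Octonion a b c}
    (hI : genI * q = q * genI) (hJ : genJ * q = q * genJ) : q = re q • 1 := by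
  have eq_neg {u : K} (hu : u = -u) : u = 0 := eq_zero_of_eq_neg K hu
  simp only [Octonion.ext_iff, QuaternionAlgebra.ext_iff] at hI hJ
  ext <;> simp at hI hJ ⊢ <;> grind

theorem eq_re_smul_one_add_smul_sub_star (x : Octonion a b c) :
    x = re x • 1 + (2 : K)⁻¹ • (x - star x) := by
  rw [star_eq_smul_one_sub, sub_sub_eq_add_sub, ← two_smul K x, smul_sub, smul_smul, smul_smul,
    inv_mul_cancel₀ two_ne_zero, inv_mul_cancel_left₀ two_ne_zero, one_smul, add_sub_cancel]

theorem map_one_of_bimodule_relation (ha : a ≠ 0) {s t : K} (hδ0 : δ ≠ 0) (hδ1 : δ ≠ 1)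
    (g : Octonion a b c →ₗ[K] Octonion a b c)
    (hl : ∀ x p, star x = -x → g (x * p) - s • (x * p) = δ • (x * (g p - s • p)))
    (hr : ∀ x p, star x = -x → g (p * x) - t • (p * x) = δ • ((g p - t • p) * x)) :
    s = t ∧ g 1 = re (g 1) • 1 := by
  have commutator_map_one {x : Octonion a b c} (hx : star x = -x) :
      δ • (x * g 1 - g 1 * x) = ((t - s) * (1 - δ)) • x := by
    have hxl := hl x 1 hx
    have hxr := hr x 1 hx
    simp only [mul_one, one_mul, mul_sub, sub_mul, mul_smul_comm, smul_mul_assoc] at hxl hxr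
    linear_combination (norm := module) hxr - hxl
  obtain rfl : s = t := by
    have h := congrArg (fun u => re (u * genI)) (commutator_map_one star_genI)
    simp only [smul_mul_assoc, map_smul, re_commutator_mul] at h
    rw [mul_sub, map_sub, ← re_mul_assoc genI (g 1), re_mul_comm (genI * g 1), sub_self, smul_zero,
      genI_mul_self] at h
    simpa [ha, sub_eq_zero, hδ1.symm, eq_comm (a := s)] using h.symm
  have commute {x : Octonion a b c} (hx : star x = -x) : x * g 1 = g 1 * x := by
    have h := commutator_map_one hx
    rw [sub_self, zero_mul, zero_smul] at h
    exact sub_eq_zero.1 ((smul_eq_zero_iff_right hδ0).1 h)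
  exact ⟨rfl, eq_re_smul_one_of_commute ha (commute star_genI) (commute star_genJ)⟩

theorem eq_smul_of_bimodule_relation (ha : a ≠ 0) {s t : K} (hδ0 : δ ≠ 0) (hδ1 : δ ≠ 1)
    (g : Octonion a b c →ₗ[K] Octonion a b c)
    (hl : ∀ x p, star x = -x → g (x * p) - s • (x * p) = δ • (x * (g p - s • p)))
    (hr : ∀ x p, star x = -x → g (p * x) - t • (p * x) = δ • ((g p - t • p) * x)) :
    s = t ∧ ∀ p, g p = s • p := by
  obtain ⟨hst, map_one⟩ := map_one_of_bimodule_relation ha hδ0 hδ1 g hl hr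
  set r := re (g 1)
  have map_of_star_eq_neg {x : Octonion a b c} (hx : star x = -x) :
      g x - s • x = (δ * (r - s)) • x := by
    have h := hl x 1 hx
    rwa [mul_one, map_one, ← sub_smul, mul_smul_one, smul_smul] at h
  have star_IJ : star (genI * genJ : Octonion a b c) = -(genI * genJ) :=
    star_mul_of_anticomm star_genI star_genJ genJ_mul_genI
  have hrs : r = s := by
    have h := hl genI genJ star_genI
    rw [map_of_star_eq_neg star_IJ, map_of_star_eq_neg star_genJ, mul_smul_comm, smul_smul] at h
    have hIJ : (genI * genJ : Octonion a b c) ≠ 0 := by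
      simp [Octonion.ext_iff, QuaternionAlgebra.ext_iff]
    have heq := smul_left_injective K hIJ h
    refine mul_left_cancel₀ (mul_ne_zero hδ0 (sub_ne_zero.2 hδ1.symm)) ?_
    linear_combination heq
  refine ⟨hst, fun p => ?_⟩
  have him := map_of_star_eq_neg (x := p - star p) (by rw [star_sub, star_star, neg_sub])
  rw [hrs, sub_self, mul_zero, zero_smul, sub_eq_zero] at him
  rw [eq_re_smul_one_add_smul_sub_star p, map_add, map_smul, map_smul, map_one, him, hrs, smul_add,
    smul_comm s, smul_comm s]

end Octonion

namespace IsDeltaDerivation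

variable {K A : Type*} [Field K] [AddCommGroup A] [Module K A] {μ : A →ₗ[K] A →ₗ[K] A} {δ : K}
  {D : A →ₗ[K] A} {e : A}

theorem map_mul_sub_smul (hD : IsDeltaDerivation μ δ D) {t : K} (ht : (2 * δ - 1) * t = 0) {x : A}
    (hx : D x = t • x) (y : A) : D (μ x y) - t • μ x y = δ • μ x (D y - t • y) := by
  rw [hD, hx, map_smul, LinearMap.smul_apply, map_sub, map_smul]
  linear_combination (norm := module) ht • μ x y

theorem one_sub_smul_map (hD : IsDeltaDerivation μ δ D) (he : ∀ x, μ e x = x) (x : A) :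
    (1 - δ) • D x = δ • μ (D e) x := by
  have hex := hD e x
  rw [he, he] at hex
  linear_combination (norm := module) hex

variable [NeZero (2 : K)]

theorem eq_one_or_eq_half (hD : IsDeltaDerivation μ δ D) (hD0 : D ≠ 0) (he : ∀ x, μ e x = x)
    (he' : ∀ x, μ x e = x) : δ = 1 ∨ δ = 1 / 2 := by
  have hee := hD.one_sub_smul_map he e
  rw [he'] at hee
  by_cases hDe : D e = 0
  · obtain ⟨x, hx⟩ := DFunLike.ne_iff.1 hD0
    have h := hD.one_sub_smul_map he x
    rw [hDe, map_zero, LinearMap.zero_apply, smul_zero] at h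
    exact .inl (sub_eq_zero.1 ((smul_eq_zero_iff_left hx).1 h)).symm
  · refine .inr ((eq_div_iff two_ne_zero).2 ?_)
    linear_combination -smul_left_injective K hDe hee

theorem map_eq_of_half (hD : IsDeltaDerivation μ (1 / 2) D) (he : ∀ x, μ e x = x) (x : A) :
    D x = μ (D e) x := by
  have h := hD.one_sub_smul_map he x
  rw [sub_half] at h
  exact smul_right_injective A (one_div_ne_zero two_ne_zero) h

end IsDeltaDerivation

namespace skewHermitianOctonionMatrix

variable {K : Type*} [Field K] {a b c : K} {n : ℕ} {i j : Fin n} {x y : Octonion a b c}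

local notation "μ" => skewHermitianOctonionMatrixMul a b c n

/-- The skew-Hermitian analogue of a matrix unit: `p` in place `(i, j)` and `-star p` in place
`(j, i)`. When `i = j` the two entries are added, so that `unit i i p` has entry `p - star p`. -/
def unit (i j : Fin n) : Octonion a b c →ₗ[K] skewHermitianOctonionMatrix a b c n where
  toFun p := ⟨Matrix.single i j p - Matrix.single j i (star p), by
    change (_ : Matrix _ _ _)ᴴ = -_
    rw [Matrix.conjTranspose_sub, Matrix.conjTranspose_single, Matrix.conjTranspose_single,
      star_star, neg_sub]⟩
  map_add' p q := Subtype.ext (by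
    simp only [Submodule.coe_add, star_add, Matrix.single_add]; abel)
  map_smul' s p := Subtype.ext (by
    simp only [Submodule.coe_smul, Octonion.star_smul', RingHom.id_apply, smul_sub,
      Matrix.smul_single])

/-- The diagonal matrix whose only nonzero entry is the imaginary part of `x`, in place `(i, i)`. -/
def diag (i : Fin n) : Octonion a b c →ₗ[K] skewHermitianOctonionMatrix a b c n :=
  (2 : K)⁻¹ • unit i i

/-- The `(i, j)` entry of a skew-Hermitian matrix, as a linear map. -/
def entry (i j : Fin n) : skewHermitianOctonionMatrix a b c n →ₗ[K] Octonion a b c where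
  toFun X := X.1 i j
  map_add' _ _ := rfl
  map_smul' _ _ := rfl

theorem coe_unit (i j : Fin n) (p : Octonion a b c) :
    (unit i j p).1 = Matrix.single i j p - Matrix.single j i (star p) := rfl

theorem entry_apply (i j : Fin n) (X : skewHermitianOctonionMatrix a b c n) :
    entry i j X = X.1 i j := rfl

theorem coe_mul (X Y : skewHermitianOctonionMatrix a b c n) :
    (μ X Y).1 = X.1 * Y.1 - Y.1 * X.1 := rfl

theorem mul_swap (X Y : skewHermitianOctonionMatrix a b c n) : μ Y X = -μ X Y :=
  Subtype.ext (by rw [Submodule.coe_neg, coe_mul, coe_mul, neg_sub])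

theorem unit_swap (i j : Fin n) (p : Octonion a b c) : unit j i (star p) = -unit i j p :=
  Subtype.ext (by rw [Submodule.coe_neg, coe_unit, coe_unit, star_star, neg_sub])

theorem entry_swap (i j : Fin n) (X : skewHermitianOctonionMatrix a b c n) :
    entry j i X = -star (entry i j X) := by
  have hX : X.1ᴴ = -X.1 := X.2
  have hji := congrFun (congrFun hX j) i
  rw [Matrix.conjTranspose_apply, Matrix.neg_apply] at hji
  rw [entry_apply, entry_apply, hji, neg_neg]

theorem ext_entry {X Y : skewHermitianOctonionMatrix a b c n}
    (h : ∀ k l, entry k l X = entry k l Y) : X = Y :=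
  Subtype.ext (Matrix.ext h)

theorem entry_unit_of_ne (hij : i ≠ j) (p : Octonion a b c) : entry i j (unit i j p) = p := by
  rw [entry_apply, coe_unit, Matrix.sub_apply, Matrix.single_apply_same,
    Matrix.single_apply_of_ne _ _ _ _ _ (fun h => hij h.2), sub_zero]

theorem eq_sum_unit [NeZero (2 : K)] (X : skewHermitianOctonionMatrix a b c n) :
    X = (2 : K)⁻¹ • ∑ i, ∑ j, unit i j (entry i j X) := by
  rw [eq_inv_smul_iff₀ two_ne_zero]
  have hX : X.1ᴴ = -X.1 := X.2
  have sum_swap : ∑ i, ∑ j, Matrix.single j i (star (X.1 i j)) = -X.1 := by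
    rw [Finset.sum_comm, ← hX]
    exact (Matrix.matrix_eq_sum_single X.1ᴴ).symm
  apply Subtype.ext
  simp only [Submodule.coe_smul, Submodule.coe_sum, coe_unit, Finset.sum_sub_distrib,
    entry_apply, sum_swap, ← Matrix.matrix_eq_sum_single]
  rw [two_smul, sub_neg_eq_add]

variable [NeZero (2 : K)]

theorem coe_diag (i : Fin n) (hx : star x = -x) : (diag i x).1 = Matrix.single i i x := by
  rw [diag, LinearMap.smul_apply, Submodule.coe_smul, coe_unit, hx, ← Matrix.single_neg,
    sub_neg_eq_add, ← two_smul K, inv_smul_smul₀ two_ne_zero]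

theorem unit_self (i : Fin n) (p : Octonion a b c) : unit i i p = diag i (p - star p) := by
  rw [diag, LinearMap.smul_apply, map_sub, unit_swap, sub_neg_eq_add, ← two_smul K (unit i i p),
    inv_smul_smul₀ two_ne_zero]

theorem linearMap_ext {V : Type*} [AddCommGroup V] [Module K V]
    {f g : skewHermitianOctonionMatrix a b c n →ₗ[K] V}
    (hdiag : ∀ i x, star x = -x → f (diag i x) = g (diag i x))
    (hunit : ∀ i j, i ≠ j → ∀ p, f (unit i j p) = g (unit i j p)) : f = g := by
  have h (i j : Fin n) (p : Octonion a b c) : f (unit i j p) = g (unit i j p) := by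
    obtain rfl | hij := eq_or_ne i j
    · rw [unit_self]
      exact hdiag i _ (by rw [star_sub, star_star, neg_sub])
    · exact hunit i j hij p
  ext X
  rw [eq_sum_unit X]
  simp only [map_smul, map_sum, h]

theorem entry_diag_mul (i k l : Fin n) (hx : star x = -x)
    (Y : skewHermitianOctonionMatrix a b c n) :
    entry k l (μ (diag i x) Y) =
      (if k = i then x * entry i l Y else 0) - (if l = i then entry k i Y * x else 0) := by
  rw [entry_apply, coe_mul, coe_diag i hx, Matrix.sub_apply]
  congr 1
  · split_ifs with h
    · rw [h, Matrix.single_mul_apply_same, entry_apply]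
    · rw [Matrix.single_mul_apply_of_ne _ _ _ _ _ h]
  · split_ifs with h
    · rw [h, Matrix.mul_single_apply_same, entry_apply]
    · rw [Matrix.mul_single_apply_of_ne _ _ _ _ _ h]

theorem diag_mul_diag (i : Fin n) (hx : star x = -x) (hy : star y = -y) :
    μ (diag i x) (diag i y) = diag i (x * y - y * x) := by
  apply Subtype.ext
  rw [coe_mul, coe_diag i hx, coe_diag i hy, coe_diag i (Octonion.star_commutator hx hy),
    Matrix.single_mul_single_same, Matrix.single_mul_single_same]
  exact (map_sub (Matrix.singleAddMonoidHom (α := Octonion a b c) i i) _ _).symm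

theorem diag_mul_diag_of_ne (hij : i ≠ j) (hx : star x = -x) (hy : star y = -y) :
    μ (diag i x) (diag j y) = 0 := by
  apply Subtype.ext
  rw [coe_mul, coe_diag i hx, coe_diag j hy, Matrix.single_mul_single_of_ne _ _ _ _ hij,
    Matrix.single_mul_single_of_ne _ _ _ _ hij.symm, sub_zero, Submodule.coe_zero]

theorem diag_mul_unit (hij : i ≠ j) (hx : star x = -x) (p : Octonion a b c) :
    μ (diag i x) (unit i j p) = unit i j (x * p) := by
  apply Subtype.ext
  rw [coe_mul, coe_diag i hx, coe_unit, coe_unit, mul_sub, sub_mul,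
    Matrix.single_mul_single_same, Matrix.single_mul_single_same,
    Matrix.single_mul_single_of_ne _ _ _ _ hij, Matrix.single_mul_single_of_ne _ _ _ _ hij.symm,
    star_mul, hx, mul_neg, ← Matrix.single_neg, sub_zero, zero_sub]

theorem eq_zero_of_map_mul_eq_zero {V : Type*} [AddCommGroup V] [Module K V] (ha : a ≠ 0)
    (hb : b ≠ 0) {f : skewHermitianOctonionMatrix a b c n →ₗ[K] V} (hf : ∀ X Y, f (μ X Y) = 0) :
    f = 0 := by
  refine linearMap_ext (fun i x hx => ?_) (fun i j hij p => ?_)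
  · refine Octonion.map_eq_zero_of_map_commutator ha hb (f ∘ₗ diag i) (fun y z hy hz => ?_) hx
    rw [LinearMap.comp_apply, ← diag_mul_diag i hy hz, hf]
  · have h := hf (diag i Octonion.genI) (unit i j (Octonion.genI * p))
    rw [diag_mul_unit hij Octonion.star_genI, Octonion.mul_mul_self, Octonion.genI_mul_self,
      smul_one_mul, map_smul, map_smul] at h
    rw [(smul_eq_zero_iff_right ha).1 h, LinearMap.zero_apply]

variable {δ : K} {k l : Fin n}
  {D f : skewHermitianOctonionMatrix a b c n →ₗ[K] skewHermitianOctonionMatrix a b c n}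

theorem map_diag_commutator (hD : IsDeltaDerivation μ δ D) (i : Fin n)
    (hx : star x = -x) (hy : star y = -y) :
    D (diag i (x * y - y * x)) =
      δ • (μ (diag i x) (D (diag i y)) - μ (diag i y) (D (diag i x))) := by
  rw [← diag_mul_diag i hx hy, hD, mul_swap (diag i y), smul_neg, smul_sub, neg_add_eq_sub]

theorem isImaginaryDeltaDerivation_entry (hD : IsDeltaDerivation μ δ D) (i : Fin n) :
    Octonion.IsImaginaryDeltaDerivation δ (entry i i ∘ₗ D ∘ₗ diag i) where
  star_map _ := neg_eq_iff_eq_neg.1 (entry_swap i i _).symm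
  map_commutator hx hy := by
    rw [LinearMap.comp_apply, LinearMap.comp_apply, map_diag_commutator hD i hx hy]
    simp only [map_smul, map_sub, entry_diag_mul i i i hx, entry_diag_mul i i i hy, if_true,
      LinearMap.comp_apply]
    module

theorem entry_map_diag_of_ne_of_ne (ha : a ≠ 0) (hb : b ≠ 0) (hD : IsDeltaDerivation μ δ D)
    (hk : k ≠ i) (hl : l ≠ i) (hx : star x = -x) : entry k l (D (diag i x)) = 0 := by
  refine Octonion.map_eq_zero_of_map_commutator ha hb (entry k l ∘ₗ D ∘ₗ diag i)
    (fun y z hy hz => ?_) hx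
  rw [LinearMap.comp_apply, LinearMap.comp_apply, map_diag_commutator hD i hy hz]
  simp only [map_smul, map_sub, entry_diag_mul i k l hy, entry_diag_mul i k l hz, if_neg hk,
    if_neg hl, sub_zero, smul_zero]

theorem entry_map_diag_of_ne (ha : a ≠ 0) (hb : b ≠ 0) (hδ0 : δ ≠ 0) (hδ1 : δ ≠ 1)
    (hD : IsDeltaDerivation μ δ D) (hij : i ≠ j) (hx : star x = -x) :
    entry i j (D (diag i x)) = 0 := by
  refine Octonion.map_eq_zero_of_intertwining ha hb hδ1 (entry i j ∘ₗ D ∘ₗ diag i)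
    (entry i j ∘ₗ D ∘ₗ diag j) (fun y z hy hz => ?_) (fun y z hy hz => ?_) hx
  · have h := hD (diag i y) (diag j z)
    rw [diag_mul_diag_of_ne hij hy hz, map_zero, ← smul_add, eq_comm,
      smul_eq_zero_iff_right hδ0, mul_swap (diag j z), neg_add_eq_sub] at h
    have hentry := congrArg (entry i j) h
    rw [map_sub, entry_diag_mul i i j hy, entry_diag_mul j i j hz, if_pos rfl, if_neg hij.symm,
      if_neg hij, if_pos rfl, sub_zero, zero_sub, sub_neg_eq_add, map_zero, add_comm] at hentry
    simpa only [LinearMap.comp_apply, add_comm] using hentry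
  · rw [LinearMap.comp_apply, LinearMap.comp_apply, map_diag_commutator hD i hy hz]
    simp only [map_smul, map_sub, entry_diag_mul i i j hy, entry_diag_mul i i j hz, if_true,
      if_neg hij.symm, sub_zero, LinearMap.comp_apply]

theorem exists_map_diag (ha : a ≠ 0) (hb : b ≠ 0) (hc : c ≠ 0) (hδ0 : δ ≠ 0) (hδ1 : δ ≠ 1)
    (hD : IsDeltaDerivation μ δ D) (i : Fin n) :
    ∃ t : K, (2 * δ - 1) * t = 0 ∧ ∀ x, star x = -x → D (diag i x) = t • diag i x := by
  obtain ⟨t, ht, h⟩ :=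
    (isImaginaryDeltaDerivation_entry hD i).eq_smul ha hb hc hδ0 hδ1
  refine ⟨t, ht, fun x hx => ext_entry fun k l => ?_⟩
  rw [map_smul, entry_apply k l (diag i x), coe_diag i hx]
  obtain rfl | hk := eq_or_ne i k <;> obtain rfl | hl := eq_or_ne i l
  · rw [Matrix.single_apply_same]
    exact h x hx
  · rw [entry_map_diag_of_ne ha hb hδ0 hδ1 hD hl hx, Matrix.single_apply_of_col_ne _ _ hl,
      smul_zero]
  · rw [entry_swap, entry_map_diag_of_ne ha hb hδ0 hδ1 hD hk hx,
      Matrix.single_apply_of_row_ne hk, star_zero, neg_zero, smul_zero]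
  · rw [entry_map_diag_of_ne_of_ne ha hb hD hk.symm hl.symm hx, Matrix.single_apply_of_row_ne hk,
      smul_zero]

theorem entry_map_unit_mul_left
    (hf : ∀ x, star x = -x → ∀ Y, f (μ (diag i x) Y) = δ • μ (diag i x) (f Y)) (hij : i ≠ j)
    (hx : star x = -x) (p : Octonion a b c) :
    entry i j (f (unit i j (x * p))) = δ • (x * entry i j (f (unit i j p))) := by
  rw [← diag_mul_unit hij hx, hf x hx, map_smul, entry_diag_mul i i j hx, if_pos rfl,
    if_neg hij.symm, sub_zero]

theorem entry_map_unit_mul_right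
    (hf : ∀ x, star x = -x → ∀ Y, f (μ (diag j x) Y) = δ • μ (diag j x) (f Y)) (hij : i ≠ j)
    (hx : star x = -x) (p : Octonion a b c) :
    entry i j (f (unit i j (p * x))) = δ • (entry i j (f (unit i j p)) * x) := by
  have h := congrArg star (entry_map_unit_mul_left hf hij.symm hx (star p))
  have hpx : x * star p = -star (p * x) := by rw [star_mul, hx, neg_mul, neg_neg]
  rw [hpx, map_neg, unit_swap, unit_swap, neg_neg] at h
  simpa only [entry_swap i j, map_neg, star_neg, star_star, neg_neg, Octonion.star_smul', star_mul,
    hx, mul_neg, smul_neg, neg_inj] using h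

theorem entry_map_unit_of_ne_of_ne (ha : a ≠ 0)
    (hf : ∀ x, star x = -x → ∀ Y, f (μ (diag i x) Y) = δ • μ (diag i x) (f Y)) (hij : i ≠ j)
    (hk : k ≠ i) (hl : l ≠ i) (p : Octonion a b c) : entry k l (f (unit i j p)) = 0 := by
  have h := congrArg (entry k l)
    (hf _ Octonion.star_genI (unit i j (Octonion.genI * p)))
  rw [diag_mul_unit hij Octonion.star_genI, Octonion.mul_mul_self, Octonion.genI_mul_self,
    smul_one_mul, map_smul, map_smul, map_smul, map_smul, entry_diag_mul i k l Octonion.star_genI,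
    if_neg hk, if_neg hl, sub_zero, smul_zero] at h
  exact (smul_eq_zero_iff_right ha).1 h

theorem map_unit_eq_zero (ha : a ≠ 0)
    (hfi : ∀ x, star x = -x → ∀ Y, f (μ (diag i x) Y) = δ • μ (diag i x) (f Y))
    (hfj : ∀ x, star x = -x → ∀ Y, f (μ (diag j x) Y) = δ • μ (diag j x) (f Y)) (hij : i ≠ j)
    {p : Octonion a b c} (hp : entry i j (f (unit i j p)) = 0) : f (unit i j p) = 0 := by
  refine ext_entry fun k l => ?_
  rw [map_zero]
  by_cases hi : k ≠ i ∧ l ≠ i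
  · exact entry_map_unit_of_ne_of_ne ha hfi hij hi.1 hi.2 p
  by_cases hj : k ≠ j ∧ l ≠ j
  · rw [← star_star p, unit_swap, map_neg, map_neg, neg_eq_zero]
    exact entry_map_unit_of_ne_of_ne ha hfj hij.symm hj.1 hj.2 _
  obtain ⟨rfl, rfl⟩ | ⟨rfl, rfl⟩ : k = i ∧ l = j ∨ k = j ∧ l = i := by grind
  · exact hp
  · rw [entry_swap, hp, star_zero, neg_zero]

theorem eq_and_map_unit_eq_smul (ha : a ≠ 0) (hδ0 : δ ≠ 0) (hδ1 : δ ≠ 1)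
    (hD : IsDeltaDerivation μ δ D) {s t : K} (hs : (2 * δ - 1) * s = 0)
    (ht : (2 * δ - 1) * t = 0) (hij : i ≠ j)
    (hi : ∀ x, star x = -x → D (diag i x) = s • diag i x)
    (hj : ∀ x, star x = -x → D (diag j x) = t • diag j x) :
    s = t ∧ ∀ p, D (unit i j p) = s • unit i j p := by
  have hfi : ∀ x, star x = -x → ∀ Y,
      (D - s • .id) (μ (diag i x) Y) = δ • μ (diag i x) ((D - s • .id) Y) :=
    fun x hx => hD.map_mul_sub_smul hs (hi x hx)
  have hfj : ∀ x, star x = -x → ∀ Y,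
      (D - t • .id) (μ (diag j x) Y) = δ • μ (diag j x) ((D - t • .id) Y) :=
    fun x hx => hD.map_mul_sub_smul ht (hj x hx)
  have entry_sub (u : K) (p : Octonion a b c) : entry i j ((D - u • .id) (unit i j p)) =
      (entry i j ∘ₗ D ∘ₗ unit i j) p - u • p := by
    rw [LinearMap.sub_apply, LinearMap.smul_apply, LinearMap.id_apply, map_sub, map_smul,
      entry_unit_of_ne hij, LinearMap.comp_apply, LinearMap.comp_apply]
  obtain ⟨rfl, hentry⟩ := Octonion.eq_smul_of_bimodule_relation ha hδ0 hδ1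
    (entry i j ∘ₗ D ∘ₗ unit i j)
    (fun x p hx => by simpa only [entry_sub] using entry_map_unit_mul_left hfi hij hx p)
    (fun x p hx => by simpa only [entry_sub] using entry_map_unit_mul_right hfj hij hx p)
  have hzero (p : Octonion a b c) : entry i j ((D - s • .id) (unit i j p)) = 0 := by
    rw [entry_sub, hentry, sub_self]
  exact ⟨rfl, fun p => sub_eq_zero.1 (map_unit_eq_zero ha hfi hfj hij (hzero p))⟩

theorem eq_half_and_eq_smul_id (ha : a ≠ 0) (hb : b ≠ 0) (hc : c ≠ 0)
    (hδ : δ ≠ 1) (hD0 : D ≠ 0) (hD : IsDeltaDerivation μ δ D) :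
    δ = 1 / 2 ∧ ∃ t : K, D = t • LinearMap.id := by
  have hδ0 : δ ≠ 0 := by
    rintro rfl
    refine hD0 (eq_zero_of_map_mul_eq_zero ha hb fun X Y => ?_)
    rw [hD, zero_smul, zero_smul, add_zero]
  choose t ht hdiag using exists_map_diag ha hb hc hδ0 hδ hD
  have hunit {i j} (hij : i ≠ j) :=
    eq_and_map_unit_eq_smul ha hδ0 hδ hD (ht i) (ht j) hij (hdiag i) (hdiag j)
  have hscalar (i) : D = t i • LinearMap.id := by
    have ht_eq (j) : t j = t i := by
      obtain rfl | hji := eq_or_ne j i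
      · rfl
      · exact (hunit hji).1
    refine linearMap_ext (fun j x hx => ?_) (fun j k hjk p => ?_)
    · rw [hdiag j x hx, ht_eq]; rfl
    · rw [(hunit hjk).2, ht_eq]; rfl
  obtain ⟨i⟩ : Nonempty (Fin n) := by
    by_contra hn
    rw [not_nonempty_iff] at hn
    exact hD0 (linearMap_ext (fun i => hn.elim i) (fun i => hn.elim i))
  have hti : t i ≠ 0 := fun h => hD0 (by rw [hscalar i, h, zero_smul])
  refine ⟨(eq_div_iff two_ne_zero).2 ?_, t i, hscalar i⟩
  linear_combination (mul_eq_zero.1 (ht i)).resolve_right hti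

end skewHermitianOctonionMatrix

namespace hermitianOctonionMatrix

variable {K : Type*} [Field K] {a b c : K} {n : ℕ} {i j : Fin n}
  {D : hermitianOctonionMatrix a b c n →ₗ[K] hermitianOctonionMatrix a b c n}

local notation "μ" => hermitianOctonionMatrixMul a b c n

/-- The identity matrix, as a Hermitian matrix. -/
def one : hermitianOctonionMatrix a b c n := ⟨1, Matrix.conjTranspose_one⟩

/-- The diagonal idempotent with entry `1` in place `(i, i)`. -/
def diag (i : Fin n) : hermitianOctonionMatrix a b c n :=
  ⟨Matrix.single i i 1, by
    change (_ : Matrix _ _ _)ᴴ = _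
    rw [Matrix.conjTranspose_single, star_one]⟩

/-- The Hermitian analogue of a matrix unit: `1` in the places `(i, j)` and `(j, i)`, added when
`i = j`. -/
def unit (i j : Fin n) : hermitianOctonionMatrix a b c n :=
  ⟨Matrix.single i j 1 + Matrix.single j i 1, by
    change (_ : Matrix _ _ _)ᴴ = _
    rw [Matrix.conjTranspose_add, Matrix.conjTranspose_single, Matrix.conjTranspose_single,
      star_one, add_comm]⟩

theorem coe_diag (i : Fin n) :
    (diag i : hermitianOctonionMatrix a b c n).1 = Matrix.single i i 1 := rfl

theorem coe_unit (i j : Fin n) : (unit i j : hermitianOctonionMatrix a b c n).1 =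
    Matrix.single i j 1 + Matrix.single j i 1 := rfl

theorem coe_mul (X Y : hermitianOctonionMatrix a b c n) :
    (μ X Y).1 = (2 : K)⁻¹ • (X.1 * Y.1 + Y.1 * X.1) := rfl

protected theorem mul_comm (X Y : hermitianOctonionMatrix a b c n) : μ X Y = μ Y X :=
  Subtype.ext (by rw [coe_mul, coe_mul, add_comm])

theorem diag_mul_unit (hij : i ≠ j) :
    μ (diag i) (unit i j) = (2 : K)⁻¹ • unit i j := by
  apply Subtype.ext
  rw [coe_mul, Submodule.coe_smul, coe_diag, coe_unit, mul_add, add_mul,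
    Matrix.single_mul_single_same, Matrix.single_mul_single_same,
    Matrix.single_mul_single_of_ne _ _ _ _ hij,
    Matrix.single_mul_single_of_ne _ _ _ _ hij.symm, one_mul, add_zero, zero_add]

theorem diag_mul_apply_of_ne (hij : i ≠ j) (Y : hermitianOctonionMatrix a b c n) :
    (μ (diag i) Y).1 i j = (2 : K)⁻¹ • Y.1 i j := by
  rw [coe_mul, Matrix.smul_apply, Matrix.add_apply, coe_diag, Matrix.single_mul_apply_same,
    Matrix.mul_single_apply_of_ne _ _ _ _ _ hij.symm, one_mul, add_zero]

variable [NeZero (2 : K)]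

protected theorem one_mul (X : hermitianOctonionMatrix a b c n) : μ one X = X :=
  Subtype.ext (by
    rw [coe_mul, one, one_mul, mul_one, ← two_smul K, inv_smul_smul₀ two_ne_zero])

theorem diag_mul_self (i : Fin n) : μ (diag i) (diag i) = diag i :=
  Subtype.ext (by
    rw [coe_mul, coe_diag, Matrix.single_mul_single_same, one_mul, ← two_smul K,
      inv_smul_smul₀ two_ne_zero])

theorem apply_eq_zero_of_diag_mul_eq_self (hij : i ≠ j) {Y : hermitianOctonionMatrix a b c n}
    (hY : μ (diag i) Y = Y) : Y.1 i j = 0 := by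
  have h := diag_mul_apply_of_ne hij Y
  rwa [hY, eq_inv_smul_iff₀ two_ne_zero, two_smul, add_eq_left] at h

theorem map_one_apply_of_ne (hD : IsDeltaDerivation μ (1 / 2) D) (hij : i ≠ j) :
    (D one).1 i j = 0 := by
  have hdiag : μ (diag i) (D (diag i)) = D (diag i) := by
    have h := hD (diag i) (diag i)
    rw [diag_mul_self, hermitianOctonionMatrix.mul_comm (D _), ← add_smul, add_halves,
      one_smul] at h
    exact h.symm
  have h := apply_eq_zero_of_diag_mul_eq_self hij hdiag
  rwa [hD.map_eq_of_half hermitianOctonionMatrix.one_mul, hermitianOctonionMatrix.mul_comm,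
    diag_mul_apply_of_ne hij, smul_eq_zero_iff_right (inv_ne_zero two_ne_zero)] at h

theorem map_one_eq_diagonal (hD : IsDeltaDerivation μ (1 / 2) D) :
    (D one).1 = Matrix.diagonal fun i => Octonion.re ((D one).1 i i) • 1 := by
  ext1 i j
  obtain rfl | hij := eq_or_ne i j
  · have hself : (D one).1ᴴ = (D one).1 := (D one).2
    rw [Matrix.diagonal_apply_eq]
    exact Octonion.eq_re_smul_one_of_star_eq (congrFun (congrFun hself i) i)
  · rw [Matrix.diagonal_apply_ne _ hij, map_one_apply_of_ne hD hij]

theorem map_apply (hD : IsDeltaDerivation μ (1 / 2) D) (X : hermitianOctonionMatrix a b c n)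
    (k l : Fin n) :
    (D X).1 k l = ((2 : K)⁻¹ * (Octonion.re ((D one).1 k k) + Octonion.re ((D one).1 l l))) •
      X.1 k l := by
  rw [hD.map_eq_of_half hermitianOctonionMatrix.one_mul, coe_mul, Matrix.smul_apply,
    Matrix.add_apply]
  conv_lhs => rw [map_one_eq_diagonal hD]
  rw [Matrix.diagonal_mul, Matrix.mul_diagonal, smul_mul_assoc, one_mul, mul_smul_comm, mul_one,
    ← add_smul, smul_smul]

theorem map_diag (hD : IsDeltaDerivation μ (1 / 2) D) (i : Fin n) :
    D (diag i) = Octonion.re ((D one).1 i i) • diag i := by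
  refine Subtype.ext (Matrix.ext fun k l => ?_)
  rw [map_apply hD, Submodule.coe_smul, Matrix.smul_apply, coe_diag]
  by_cases h : i = k ∧ i = l
  · obtain ⟨rfl, rfl⟩ := h
    rw [← two_mul, inv_mul_cancel_left₀ two_ne_zero]
  · rw [Matrix.single_apply_of_ne _ _ _ _ _ h, smul_zero, smul_zero]

theorem re_map_one_apply_eq (hD : IsDeltaDerivation μ (1 / 2) D) (i j : Fin n) :
    Octonion.re ((D one).1 i i) = Octonion.re ((D one).1 j j) := by
  obtain rfl | hij := eq_or_ne i j
  · rfl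
  have hdiag := map_diag hD i
  have hunit_ij := map_apply hD (unit i j) i j
  generalize Octonion.re ((D one).1 i i) = s at hdiag hunit_ij ⊢
  generalize Octonion.re ((D one).1 j j) = t at hunit_ij ⊢
  have hZ : μ (diag i) (D (unit i j) - s • unit i j) = D (unit i j) - s • unit i j := by
    have h := hD.map_mul_sub_smul (by rw [mul_one_div_cancel two_ne_zero, sub_self, zero_mul])
      hdiag (unit i j)
    rw [diag_mul_unit hij, map_smul] at h
    apply smul_right_injective _ (inv_ne_zero (two_ne_zero (α := K)))
    linear_combination (norm := module) -h
  have hunit : (unit i j : hermitianOctonionMatrix a b c n).1 i j = 1 := by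
    rw [coe_unit, Matrix.add_apply, Matrix.single_apply_same,
      Matrix.single_apply_of_ne _ _ _ _ _ (fun h => hij h.1.symm), add_zero]
  have h := apply_eq_zero_of_diag_mul_eq_self hij hZ
  rw [Submodule.coe_sub, Matrix.sub_apply, hunit_ij, Submodule.coe_smul,
    Matrix.smul_apply, hunit, sub_eq_zero] at h
  have hmean : (2 : K)⁻¹ * (s + t) = s := by simpa using congrArg Octonion.re h
  rw [inv_mul_eq_iff_eq_mul₀ two_ne_zero] at hmean
  linear_combination -hmean

theorem eq_smul_id (hD : IsDeltaDerivation μ (1 / 2) D) : ∃ t : K, D = t • LinearMap.id := by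
  obtain ⟨t, ht⟩ : ∃ t : K, ∀ i, Octonion.re ((D one).1 i i) = t := by
    obtain hn | ⟨⟨i⟩⟩ := isEmpty_or_nonempty (Fin n)
    · exact ⟨0, fun i => hn.elim i⟩
    · exact ⟨_, fun j => re_map_one_apply_eq hD j i⟩
  refine ⟨t, LinearMap.ext fun X => Subtype.ext (Matrix.ext fun k l => ?_)⟩
  rw [map_apply hD, ht, ht, ← two_mul, inv_mul_cancel_left₀ two_ne_zero]
  rfl

theorem eq_one_or_eq_half_and_eq_smul_id {δ : K} (hD0 : D ≠ 0) (hD : IsDeltaDerivation μ δ D) :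
    δ = 1 ∨ (δ = 1 / 2 ∧ ∃ t : K, D = t • LinearMap.id) := by
  have hmul_one (X : hermitianOctonionMatrix a b c n) : μ X one = X := by
    rw [hermitianOctonionMatrix.mul_comm, hermitianOctonionMatrix.one_mul]
  obtain rfl | rfl := hD.eq_one_or_eq_half hD0 hermitianOctonionMatrix.one_mul hmul_one
  exacts [.inl rfl, .inr ⟨rfl, eq_smul_id hD⟩]

end hermitianOctonionMatrix

theorem theorem2_general {K : Type*} [Field K] (h2 : (2 : K) ≠ 0)
    (a b c : K) (ha : a ≠ 0) (hb : b ≠ 0) (hc : c ≠ 0) (n : ℕ) (δ : K) :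
    (∀ D : hermitianOctonionMatrix a b c n →ₗ[K] hermitianOctonionMatrix a b c n,
      D ≠ 0 → IsDeltaDerivation (hermitianOctonionMatrixMul a b c n) δ D →
        δ = 1 ∨ (δ = 1 / 2 ∧ ∃ t : K, D = t • LinearMap.id)) ∧
    (∀ D : skewHermitianOctonionMatrix a b c n →ₗ[K] skewHermitianOctonionMatrix a b c n,
      D ≠ 0 → IsDeltaDerivation (skewHermitianOctonionMatrixMul a b c n) δ D →
        δ = 1 ∨ (δ = 1 / 2 ∧ ∃ t : K, D = t • LinearMap.id)) :=
  haveI : NeZero (2 : K) := ⟨h2⟩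
  ⟨fun _ hD0 hD => hermitianOctonionMatrix.eq_one_or_eq_half_and_eq_smul_id hD0 hD,
    fun _ hD0 hD => or_iff_not_imp_left.2 fun hδ =>
      skewHermitianOctonionMatrix.eq_half_and_eq_smul_id ha hb hc hδ hD0 hD⟩

theorem theorem2 {K : Type*} [Field K] (h2 : (2 : K) ≠ 0) (h3 : (3 : K) ≠ 0)
    (a b c : K) (ha : a ≠ 0) (hb : b ≠ 0) (hc : c ≠ 0) (n : ℕ) (δ : K) :
    (∀ D : hermitianOctonionMatrix a b c n →ₗ[K] hermitianOctonionMatrix a b c n,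
      D ≠ 0 → IsDeltaDerivation (hermitianOctonionMatrixMul a b c n) δ D →
        δ = 1 ∨ (δ = 1 / 2 ∧ ∃ t : K, D = t • LinearMap.id)) ∧
    (∀ D : skewHermitianOctonionMatrix a b c n →ₗ[K] skewHermitianOctonionMatrix a b c n,
      D ≠ 0 → IsDeltaDerivation (skewHermitianOctonionMatrixMul a b c n) δ D →
        δ = 1 ∨ (δ = 1 / 2 ∧ ∃ t : K, D = t • LinearMap.id)) :=
  theorem2_general h2 a b c ha hb hc n δ
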